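/- Let \(k\) be a field (of any characteristic), let \(m\ge 6\), and put \(n=3m+1\). Let \(S'=k[a_i,b_i,c_i,d]_{i=1}^m\) be the polynomial ring in \(n\) variables, with the indices \(i\) read modulo \(m\). Let \(P\) be the associated divided power module, that is, the space of \(k\)-linear functionals on \(S'\) that vanish on \((S'_+)^N\) for all \(N\gg 0\), where \(S'_+\) is the ideal generated by the variables. The ring \(S'\) acts on \(P\) by contraction, \((s\cdot f)(t)=f(st)\). For \(f\in P\) let \(\mathrm{Ann}(f)=\{s\in S' : s\cdot f=0\}\) and \(\mathrm{Apolar}(f)=S'/\mathrm{Ann}(f)\). Consider the cubic \[F'=\sum_{i=1}^m \left(a_ib_ic_i+a_ia_{i+1}^2+b_ib_{i+1}^2+c_ic_{i+1}^2+a_ib_{i+1}d\right),\] and denote also by \(F'\) its dual element in \(P\), obtained by replacing each monomial by the element of the dual basis of \(P\) corresponding to it. Then \(F'\) is homogeneous of degree \(3\) in \(P\), and \(\mathrm{Apolar}(F')\) satisfies the small tangent space condition: with \(I=\mathrm{Ann}(F')\), the algebra \(S'/I\) has Hilbert function \((1,n,n,1)\) (and \(0\) in all degrees \(\ge 4\)),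 \(H(S'/I^2)_4=n\), and \(H(S'/I^2)_5=0\). Here \(H(M)_i\) denotes the dimension over \(k\) of the degree \(i\) part of \(M\). -/

import Mathlib

namespace SmallTangent

noncomputable section

open MvPolynomial

/-! ### The divided power module, contraction, apolar algebras -/

section Apolar

variable (σ : Type*) (k : Type*) [Field k]

/-- The divided power module `P` associated with the polynomial ring `S = k[σ]`: the space of
those `k`-linear functionals on `S` that vanish on `(S₊)^N` for all sufficiently large `N`,
where `S₊` is the ideal generated by the variables. -/
def dividedPower : Submodule k (Module.Dual k (MvPolynomial σ k)) where
  carrier := {f | ∃ N₀ : ℕ, ∀ N ≥ N₀, ∀ s ∈ (idealOfVars σ k) ^ N, f s = 0}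
  zero_mem' := ⟨0, fun _ _ _ _ => rfl⟩
  add_mem' := by
    rintro f g ⟨M, hM⟩ ⟨N, hN⟩
    refine ⟨max M N, fun L hL s hs => ?_⟩
    rw [LinearMap.add_apply, hM L (le_of_max_le_left hL) s hs,
      hN L (le_of_max_le_right hL) s hs, add_zero]
  smul_mem' := by
    rintro c f ⟨M, hM⟩
    refine ⟨M, fun L hL s hs => ?_⟩
    rw [LinearMap.smul_apply, hM L hL s hs, smul_zero]

variable {σ k}

/-- Contraction: the action of `S` on `P` given by `(s · f)(t) = f (s * t)`. -/
def contract (s : MvPolynomial σ k) (f : dividedPower σ k) : dividedPower σ k :=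
  ⟨f.1 ∘ₗ LinearMap.mulLeft k s, by
    obtain ⟨N₀, h⟩ := f.2
    exact ⟨N₀, fun N hN t ht => h N hN (s * t) (Ideal.mul_mem_left _ s ht)⟩⟩

/-- The element `x^[a]` of `P` dual to the monomial `α^a`. -/
def dualMonomial (a : σ →₀ ℕ) : dividedPower σ k :=
  ⟨lcoeff k a, a.degree + 1, fun N hN s hs =>
    (mem_pow_idealOfVars_iff' N s).1 hs a (by omega)⟩

/-- The `k`-linear map from `S` to `P` sending each monomial `α^a` to `x^[a]`; it sends a
polynomial to its dual element in the divided power module. -/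
def dualElement : MvPolynomial σ k →ₗ[k] dividedPower σ k :=
  (basisMonomials σ k).constr k dualMonomial

/-- An element of `P` is homogeneous of degree `d` if it is in the span of the `x^[a]` with
`|a| = d`. -/
def IsHomogeneousOfDegree (f : dividedPower σ k) (d : ℕ) : Prop :=
  f ∈ Submodule.span k {g | ∃ a : σ →₀ ℕ, a.degree = d ∧ g = dualMonomial a}

/-- The apolar ideal `Ann(f) = {s ∈ S : s · f = 0}`. -/
def Ann (f : dividedPower σ k) : Ideal (MvPolynomial σ k) where
  carrier := {s | contract s f = 0}
  zero_mem' := by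
    ext t
    simp [contract]
  add_mem' := by
    intro s t hs ht
    have hs' : ∀ u, f.1 (s * u) = 0 := fun u => LinearMap.congr_fun (Subtype.ext_iff.1 hs) u
    have ht' : ∀ u, f.1 (t * u) = 0 := fun u => LinearMap.congr_fun (Subtype.ext_iff.1 ht) u
    refine Subtype.ext (LinearMap.ext fun u => ?_)
    change f.1 ((s + t) * u) = 0
    rw [add_mul, map_add, hs', ht', add_zero]
  smul_mem' := by
    intro c s hs
    have hs' : ∀ u, f.1 (s * u) = 0 := fun u => LinearMap.congr_fun (Subtype.ext_iff.1 hs) u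
    refine Subtype.ext (LinearMap.ext fun u => ?_)
    change f.1 (c * s * u) = 0
    rw [mul_comm c s, mul_assoc, hs']

/-- The apolar algebra `Apolar(f) = S / Ann(f)`. -/
abbrev Apolar (f : dividedPower σ k) : Type _ := MvPolynomial σ k ⧸ Ann f

/-- The degree `i` part of `S / I`, for a homogeneous ideal `I`: the image of the space of
homogeneous polynomials of degree `i`. -/
def gradedPart (I : Ideal (MvPolynomial σ k)) (i : ℕ) : Submodule k (MvPolynomial σ k ⧸ I) :=
  (homogeneousSubmodule σ k i).map (Ideal.Quotient.mkₐ k I).toLinearMap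

/-- The Hilbert function `H(S/I)_i` of `S / I`, for a homogeneous ideal `I` in finitely many
variables. -/
def hilbertFunction (I : Ideal (MvPolynomial σ k)) (i : ℕ) : ℕ :=
  Module.finrank k (gradedPart I i)

/-- The small tangent space condition for `Apolar(f)`, where `f` is a homogeneous element of
degree `3` of the divided power module in the `n` variables `σ`: `f` is homogeneous of degree
`3`, the algebra `S / Ann(f)` has Hilbert function `(1, n, n, 1)`, `H(S / Ann(f)²)_4 = n`, and
`H(S / Ann(f)²)_5 = 0`. -/
structure SmallTangentSpaceCondition [Fintype σ] (f : dividedPower σ k) : Prop where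
  homogeneous : IsHomogeneousOfDegree f 3
  hilbert_zero : hilbertFunction (Ann f) 0 = 1
  hilbert_one : hilbertFunction (Ann f) 1 = Fintype.card σ
  hilbert_two : hilbertFunction (Ann f) 2 = Fintype.card σ
  hilbert_three : hilbertFunction (Ann f) 3 = 1
  hilbert_ge_four : ∀ i, 4 ≤ i → hilbertFunction (Ann f) i = 0
  hilbert_sq_four : hilbertFunction ((Ann f) ^ 2) 4 = Fintype.card σ
  hilbert_sq_five : hilbertFunction ((Ann f) ^ 2) 5 = 0

end Apolar

/-! ### The cubic -/

section Cubic

/-- The `3m + 1` variables `aᵢ, bᵢ, cᵢ, d`, with the index `i` taken modulo `m`. -/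
abbrev Var (m : ℕ) : Type := (Fin 3 × ZMod m) ⊕ Unit

variable (k : Type*) [Field k] (m : ℕ)

/-- The variable `aᵢ`. -/
def a (i : ZMod m) : MvPolynomial (Var m) k := X (Sum.inl (0, i))

/-- The variable `bᵢ`. -/
def b (i : ZMod m) : MvPolynomial (Var m) k := X (Sum.inl (1, i))

/-- The variable `cᵢ`. -/
def c (i : ZMod m) : MvPolynomial (Var m) k := X (Sum.inl (2, i))

/-- The variable `d`. -/
def d : MvPolynomial (Var m) k := X (Sum.inr ())

/-- `F = ∑ᵢ aᵢ bᵢ cᵢ + aᵢ aᵢ₊₁² + bᵢ bᵢ₊₁² + cᵢ cᵢ₊₁²`. -/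
def cubicF [NeZero m] : MvPolynomial (Var m) k :=
  ∑ i : ZMod m, (a k m i * b k m i * c k m i + a k m i * a k m (i + 1) ^ 2
    + b k m i * b k m (i + 1) ^ 2 + c k m i * c k m (i + 1) ^ 2)

/-- `F' = F + ∑ᵢ aᵢ bᵢ₊₁ d`. -/
def cubicF' [NeZero m] : MvPolynomial (Var m) k :=
  cubicF k m + ∑ i : ZMod m, a k m i * b k m (i + 1) * d k m

end Cubic

end

end SmallTangent

/-! Write `I` for the apolar ideal. Two variables `y`, `z` (possibly equal) have at most one third
variable `v` with `v * y * z` a monomial of `F'`; this is `third`. All coefficients being 1, `y * z`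
contracts `F'` to the dual of that variable, or to zero for a "zero pair". So `I` contains the zero
pairs and the differences of pairs with the same third variable, in every characteristic; this gives
the Hilbert function of the apolar algebra.

In degree 4, the functionals `p ↦ F'(∂p/∂v)` kill `I ^ 2` by the Leibniz rule and are dual to the
quartics `v * aⱼ * bⱼ * cⱼ`, with `j` not the index of `v`; hence the dimension is at least `n`. For
the upper bound, `defect` subtracts from the class of a quartic its expected combination of these.
It kills products of two elements of `I` and the chosen quartics, and `QuarticRelations.eq_zero`
shows that such a map vanishes on all products of four variables. A zero pair times a pair with
third variable `u` is recombined into zero pairs if `u` is not in the zero pair; otherwise vanishing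
spreads from a chosen quartic along the monomials of `F'`. Products without zero pairs are reduced
to products with one by `(wx - w'x')(yz - y'z')`. Collinearity is local in the index, so finite
checks over `ℤ` suffice, and they carry over to `ZMod m`.

In degree 5, the class of `w * aⱼ * bⱼ * cⱼ` does not depend on `j`. Choosing `j` away from both `v`
and `w` splits `v * w * aⱼ * bⱼ * cⱼ` into a quadric and a cubic of `I`. -/

namespace SmallTangent

/-! ### Collinearity of the variables -/

section Collinearity

/-- The variables `aᵢ, bᵢ, cᵢ, d`, with index `i` in `R`. -/
abbrev IndexedVar (R : Type*) : Type _ := (Fin 3 × R) ⊕ Unit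

variable {R : Type*} [CommRing R] [DecidableEq R]

/-- The variable `v` such that `v * x * y` is a monomial of the cubic `F'`, if there is one. -/
def third : IndexedVar R → IndexedVar R → Option (IndexedVar R)
  | .inl (s, i), .inl (t, j) =>
    if s = t then
      if j = i then some (.inl (s, i - 1))
      else if j = i + 1 then some (.inl (s, j))
      else if i = j + 1 then some (.inl (s, i))
      else none
    else if j = i then some (.inl (-(s + t), i))
    else if s = 0 ∧ t = 1 ∧ j = i + 1 then some (.inr ())
    else if s = 1 ∧ t = 0 ∧ i = j + 1 then some (.inr ())
    else none
  | .inl (s, i), .inr _ =>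
    if s = 0 then some (.inl (1, i + 1)) else if s = 1 then some (.inl (0, i - 1)) else none
  | .inr _, .inl (s, i) =>
    if s = 0 then some (.inl (1, i + 1)) else if s = 1 then some (.inl (0, i - 1)) else none
  | .inr _, .inr _ => none

/-- Pairs of variables with the given third variable (for `d`, only two of them). -/
def pairsOf : IndexedVar R → List (IndexedVar R × IndexedVar R)
  | .inl (t, i) =>
    [(.inl (t + 1, i), .inl (t + 2, i)), (.inl (t, i + 1), .inl (t, i + 1)),
      (.inl (t, i), .inl (t, i - 1))] ++
    (if t = 0 then [(.inl (1, i + 1), .inr ())] else []) ++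
    (if t = 1 then [(.inl (0, i - 1), .inr ())] else [])
  | .inr _ => [(.inl (0, 0), .inl (1, 1)), (.inl (0, -1), .inl (1, 0))]

/-- The indices, if any, differ by at most `4`. -/
def isNear : IndexedVar ℤ → IndexedVar ℤ → Bool
  | .inl (_, i), .inl (_, j) => decide (i ≤ j + 4) && decide (j ≤ i + 4)
  | _, _ => true

/-- Nearby variables that lie in no common monomial of the cubic; this persists modulo `m ≥ 6`. -/
def nearZero (x y : IndexedVar ℤ) : Bool := isNear x y && (third x y).isNone

/-- The pairs `w, x` and `y, z` can be recombined into two zero pairs. -/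
def zeroSplit (w x y z : IndexedVar ℤ) : Bool :=
  (nearZero w y && nearZero x z) || (nearZero w z && nearZero x y)

/-- The product of the zero pair `w, x` with a pair with third variable `u` vanishes after one
recombination. -/
def directZero (w x u : IndexedVar ℤ) : Bool :=
  if u.isLeft then (pairsOf u).any fun q => zeroSplit w x q.1 q.2 else w.isLeft && x.isLeft

/-- `w, x` is a zero pair to which `directZero` applies for the third variable of `y, z`. -/
def directZeroPair (w x y z : IndexedVar ℤ) : Bool :=
  nearZero w x && match third y z with
  | some u => directZero w x u
  | none => false

/-- The product of the zero pair `w, x` with a pair with third variable `u` vanishes after two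
recombinations. -/
def indirectZero (w x u : IndexedVar ℤ) : Bool :=
  (pairsOf u).any fun q =>
    directZeroPair w q.1 x q.2 || directZeroPair x q.2 w q.1 ||
    directZeroPair w q.2 x q.1 || directZeroPair x q.1 w q.2

/-- The variables with index between `-2` and `2`. -/
def window : List (IndexedVar ℤ) :=
  .inr () :: ([0, 1, 2] : List (Fin 3)).flatMap fun t =>
    ([-2, -1, 0, 1, 2] : List ℤ).map fun e => .inl (t, e)

/-- The local part of `eq_zero_of_third_ne`: the third variable is translated to index 0. -/
theorem window_zero : (([0, 1, 2] : List (Fin 3)).all fun t =>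
    window.all fun w => window.all fun x =>
    !(nearZero w x) || decide (w = .inl (t, 0)) || decide (x = .inl (t, 0)) ||
      directZero w x (.inl (t, 0)) || indirectZero w x (.inl (t, 0))) = true := by
  decide +kernel

/-- Two of the four variables form a zero pair. -/
def hasZero (w x y z : IndexedVar ℤ) : Bool :=
  nearZero w x || nearZero w y || nearZero w z || nearZero x y || nearZero x z || nearZero y z

/-- Replacing `w, x` and `y, z` by pairs with the same third variables leads to `P`. -/
def exchange (P : IndexedVar ℤ → IndexedVar ℤ → IndexedVar ℤ → IndexedVar ℤ → Bool)
    (w x y z : IndexedVar ℤ) : Bool :=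
  match third w x, third y z with
  | some u, some v => (pairsOf u).any fun q => (pairsOf v).any fun r =>
      P q.1 q.2 y z && P w x r.1 r.2 && P q.1 q.2 r.1 r.2
  | _, _ => false

/-- `P` holds, or it is reached from one of the three splits into pairs. -/
def exchangeAny (P : IndexedVar ℤ → IndexedVar ℤ → IndexedVar ℤ → IndexedVar ℤ → Bool)
    (w x y z : IndexedVar ℤ) : Bool :=
  P w x y z || exchange P w x y z || exchange P w y x z || exchange P w z x y

/-- Two rounds of exchange suffice to make a zero pair appear in every term. -/
theorem window_clique : (([0, 1, 2] : List (Fin 3)).all fun t =>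
    window.all fun x => window.all fun y => window.all fun z => exchangeAny (exchangeAny hasZero) (.inl (t, 0)) x y z) = true := by
  decide +kernel

end Collinearity

/-! ### From integer indices to indices modulo `m` -/

section Transfer

variable {m : ℕ}

/-- The bound 5 is what `isNear` needs: indices differ by at most 4, and collinearity compares them
up to a shift by 1. -/
theorem eq_zero_of_intCast_eq_zero (hm : 6 ≤ m) {e : ℤ} (h : (e : ZMod m) = 0) (h₁ : -5 ≤ e)
    (h₂ : e ≤ 5) : e = 0 := by
  rw [ZMod.intCast_zmod_eq_zero_iff_dvd] at h
  obtain ⟨q, rfl⟩ := h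
  rcases lt_trichotomy q 0 with hq | rfl | hq
  · nlinarith [(by exact_mod_cast hm : (6 : ℤ) ≤ m)]
  · simp
  · nlinarith [(by exact_mod_cast hm : (6 : ℤ) ≤ m)]

/-- Translation of integer indices by `l`, followed by reduction modulo `m`. -/
def shift (l : ZMod m) : IndexedVar ℤ → IndexedVar (ZMod m) :=
  Sum.map (fun p => (p.1, l + (p.2 : ZMod m))) id

@[simp] theorem shift_inl (l : ZMod m) (t : Fin 3) (e : ℤ) :
    shift l (.inl (t, e)) = .inl (t, l + (e : ZMod m)) := rfl

@[simp] theorem shift_inr (l : ZMod m) (u : Unit) : shift l (.inr u) = .inr u := rfl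

theorem add_one_ne_self (hm : 6 ≤ m) (i : ZMod m) : i ≠ i + 1 := fun h =>
  absurd (eq_zero_of_intCast_eq_zero (e := 1) hm (by push_cast; linear_combination -h)
    (by norm_num) (by norm_num)) (by norm_num)

theorem add_one_add_one_ne_self (hm : 6 ≤ m) (i : ZMod m) : i ≠ i + 1 + 1 := fun h =>
  absurd (eq_zero_of_intCast_eq_zero (e := 2) hm (by push_cast; linear_combination -h)
    (by norm_num) (by norm_num)) (by norm_num)

theorem third_shift (hm : 6 ≤ m) (l : ZMod m) {x y v : IndexedVar ℤ} (h : third x y = some v) :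
    third (shift l x) (shift l y) = some (shift l v) := by
  have h1 := add_one_ne_self hm
  have h2 := add_one_add_one_ne_self hm
  obtain ⟨s, i⟩ | ⟨⟩ := x <;> obtain ⟨t, j⟩ | ⟨⟩ := y
  · simp only [third] at h
    split_ifs at h with c₁ c₂ c₃ c₄ c₅ c₆ c₇
    · obtain rfl := Option.some.inj h
      simp [third, c₁, c₂, add_sub_assoc]
    · obtain rfl := Option.some.inj h
      have e1 : l + (i : ZMod m) ≠ l + (i : ZMod m) + 1 := h1 _
      simp only [shift_inl, third, c₁, c₃, if_true, Int.cast_add, Int.cast_one, ← add_assoc,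
        if_neg e1.symm]
    · obtain rfl := Option.some.inj h
      have e1 : l + (j : ZMod m) ≠ l + (j : ZMod m) + 1 := h1 _
      have e2 : l + (j : ZMod m) ≠ l + (j : ZMod m) + 1 + 1 := h2 _
      simp only [shift_inl, third, c₁, c₄, if_true, Int.cast_add, Int.cast_one, ← add_assoc,
        if_neg e1, if_neg e2]
    · obtain rfl := Option.some.inj h
      simp [third, c₁, c₅]
    · obtain rfl := Option.some.inj h
      obtain ⟨rfl, rfl, rfl⟩ := c₆
      have e1 : l + (i : ZMod m) ≠ l + (i : ZMod m) + 1 := h1 _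
      simp [third, ← add_assoc, e1.symm]
    · obtain rfl := Option.some.inj h
      obtain ⟨rfl, rfl, rfl⟩ := c₇
      have e1 : l + (j : ZMod m) ≠ l + (j : ZMod m) + 1 := h1 _
      simp [third, ← add_assoc, e1]
  · simp only [third] at h
    split_ifs at h with c₁ c₂ <;> obtain rfl := Option.some.inj h <;>
      simp [third, add_assoc, add_sub_assoc, *]
  · simp only [third] at h
    split_ifs at h with c₁ c₂ <;> obtain rfl := Option.some.inj h <;>
      simp [third, add_assoc, add_sub_assoc, *]
  · simp [third] at h

theorem third_shift_of_nearZero (hm : 6 ≤ m) (l : ZMod m) {x y : IndexedVar ℤ}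
    (h : nearZero x y = true) : third (shift l x) (shift l y) = none := by
  have key (e : ℤ) (h₁ : -5 ≤ e) (h₂ : e ≤ 5) (h₃ : e ≠ 0) : (e : ZMod m) ≠ 0 := fun h₀ =>
    h₃ (eq_zero_of_intCast_eq_zero hm h₀ h₁ h₂)
  obtain ⟨s, i⟩ | ⟨⟩ := x <;> obtain ⟨t, j⟩ | ⟨⟩ := y
  · simp only [nearZero, isNear, third, Bool.and_eq_true, decide_eq_true_eq] at h
    obtain ⟨⟨ha, hb⟩, h⟩ := h
    have e0 : j ≠ i → l + (j : ZMod m) ≠ l + (i : ZMod m) := fun hne heq =>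
      key (j - i) (by omega) (by omega) (by omega) (by push_cast; linear_combination heq)
    have e1 : j ≠ i + 1 → l + (j : ZMod m) ≠ l + (i : ZMod m) + 1 := fun hne heq =>
      key (j - i - 1) (by omega) (by omega) (by omega) (by push_cast; linear_combination heq)
    have e2 : i ≠ j + 1 → l + (i : ZMod m) ≠ l + (j : ZMod m) + 1 := fun hne heq =>
      key (i - j - 1) (by omega) (by omega) (by omega) (by push_cast; linear_combination heq)
    split_ifs at h <;> simp_all [third] <;> grind
  · simp only [nearZero, isNear, third] at h
    split_ifs at h <;> simp_all [third]
  · simp only [nearZero, isNear, third] at h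
    split_ifs at h <;> simp_all [third]
  · simp [third]

theorem third_eq_of_mem_pairsOf {u : IndexedVar ℤ} {q : IndexedVar ℤ × IndexedVar ℤ}
    (h : q ∈ pairsOf u) : third q.1 q.2 = some u := by
  obtain ⟨t, i⟩ | ⟨⟩ := u
  · fin_cases t <;> simp [pairsOf] at h <;> simp [third] <;> grind
  · simp [pairsOf] at h
    rcases h with rfl | rfl <;> simp [third]

/-- The tests in `third` are ordered asymmetrically; for large `m` at most one of `j = i`, `j = i +
1`, `i = j + 1` holds, so the order is harmless. -/
theorem third_comm (hm : 6 ≤ m) (x y : IndexedVar (ZMod m)) : third x y = third y x := by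
  have h1 := add_one_ne_self hm
  have h2 := add_one_add_one_ne_self hm
  obtain ⟨s, i⟩ | ⟨⟩ := x <;> obtain ⟨t, j⟩ | ⟨⟩ := y
  · simp only [third]
    have := h1 i
    have := h2 i
    have := h1 j
    have := h2 j
    have := add_comm s t
    grind
  all_goals simp [third]

end Transfer

/-! ### The quartic relations: zero pairs against a third variable outside the pair -/

section Vanishing

/-- The relations satisfied by the products of four variables under a linear map that vanishes on
the products of two quadrics in the apolar ideal, together with a normalization. -/
structure QuarticRelations {m : ℕ} {W : Type*} [AddCommGroup W]
    (Q : IndexedVar (ZMod m) → IndexedVar (ZMod m) → IndexedVar (ZMod m) →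
      IndexedVar (ZMod m) → W) : Prop where
  swap_left : ∀ w x y z, Q w x y z = Q x w y z
  swap_mid : ∀ w x y z, Q w x y z = Q w y x z
  swap_right : ∀ w x y z, Q w x y z = Q w x z y
  zero_zero : ∀ {w x y z}, third w x = none → third y z = none → Q w x y z = 0
  zero_congr : ∀ {w x y z y' z'}, third w x = none → third y z = third y' z' →
    Q w x y z = Q w x y' z'
  exchange : ∀ {w x y z w' x' y' z'}, third w x = third w' x' → third y z = third y' z' →
    Q w x y z + Q w' x' y' z' = Q w x y' z' + Q w' x' y z
  base : ∀ (t : Fin 3) i, Q (.inl (t, i)) (.inl (0, i + 1)) (.inl (1, i + 1)) (.inl (2, i + 1)) = 0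
  base_d : Q (.inr ()) (.inl (0, 0)) (.inl (1, 0)) (.inl (2, 0)) = 0

namespace QuarticRelations

variable {m : ℕ} {W : Type*} [AddCommGroup W]
  {Q : IndexedVar (ZMod m) → IndexedVar (ZMod m) → IndexedVar (ZMod m) → IndexedVar (ZMod m) → W}

theorem swap_pairs (H : QuarticRelations Q) (w x y z) : Q w x y z = Q y z w x := by
  rw [H.swap_mid, H.swap_left, H.swap_right, H.swap_mid]

/-- Vanishing from a split of the four variables into two zero pairs. -/
theorem eq_zero_of_zeroSplit (H : QuarticRelations Q) (hm : 6 ≤ m) (l : ZMod m)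
    {w x y z : IndexedVar ℤ} (h : zeroSplit w x y z = true) :
    Q (shift l w) (shift l x) (shift l y) (shift l z) = 0 := by
  simp only [zeroSplit, Bool.or_eq_true, Bool.and_eq_true] at h
  rcases h with ⟨h₁, h₂⟩ | ⟨h₁, h₂⟩
  · rw [H.swap_mid]
    exact H.zero_zero (third_shift_of_nearZero hm l h₁) (third_shift_of_nearZero hm l h₂)
  · rw [H.swap_right, H.swap_mid]
    exact H.zero_zero (third_shift_of_nearZero hm l h₁) (third_shift_of_nearZero hm l h₂)

theorem third_shift_of_mem_pairsOf (hm : 6 ≤ m) (l : ZMod m) {u : IndexedVar ℤ}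
    {q : IndexedVar ℤ × IndexedVar ℤ} (h : q ∈ pairsOf u) :
    third (shift l q.1) (shift l q.2) = some (shift l u) :=
  third_shift hm l (third_eq_of_mem_pairsOf h)

theorem exists_notMem_of_card_le_five (hm : 6 ≤ m) [NeZero m] (s : Finset (ZMod m))
    (hs : s.card ≤ 5) : ∃ j, j ∉ s := by
  by_contra! h
  have : s = Finset.univ := Finset.eq_univ_of_forall h
  rw [this, Finset.card_univ, ZMod.card] at hs
  omega

theorem third_d_pair (hm : 6 ≤ m) (j : ZMod m) :
    third (.inl (0, j)) (.inl (1, j + 1)) = some (.inr ()) := by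
  have h1 := (add_one_ne_self hm j).symm
  simp [third, h1]

/-- Replace `y, z` by `aⱼ, bⱼ₊₁` with `j` chosen so that both recombined pairs are zero pairs. This
excludes at most five values of `j`, except for an `a` followed by a `b`, where six would be
excluded. -/
theorem eq_zero_of_third_d_aux (H : QuarticRelations Q) (hm : 6 ≤ m) [NeZero m] {s t : Fin 3}
    {i i' : ZMod m} {y z} (hwx : third (.inl (s, i)) (.inl (t, i')) = none)
    (hyz : third y z = some (.inr ())) (hst : ¬ (s = 0 ∧ t = 1)) :
    Q (.inl (s, i)) (.inl (t, i')) y z = 0 := by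
  suffices ∃ j, third (.inl (s, i)) (.inl (0, j)) = none ∧
      third (.inl (t, i')) (.inl (1, j + 1)) = none by
    obtain ⟨j, h₁, h₂⟩ := this
    rw [H.zero_congr hwx (hyz.trans (third_d_pair hm j).symm), H.swap_mid]
    exact H.zero_zero h₁ h₂
  have avoid (a b c d e : ZMod m) : ∃ j, j ≠ a ∧ j ≠ b ∧ j ≠ c ∧ j ≠ d ∧ j ≠ e := by
    obtain ⟨j, hj⟩ := exists_notMem_of_card_le_five hm {a, b, c, d, e} Finset.card_le_five
    exact ⟨j, by simpa using hj⟩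
  fin_cases s
  · obtain ⟨j, h₁, h₂, h₃, h₄, h₅⟩ := avoid i (i - 1) (i + 1) (i' - 1) i'
    refine ⟨j, ?_, ?_⟩
    · simp only [third]; grind
    · fin_cases t
      · simp [third]; grind
      · simp at hst
      · simp [third]; grind
  · obtain ⟨j, h₁, h₂, h₃, h₄, h₅⟩ := avoid i (i - 1) (i' - 1) i' (i' - 2)
    refine ⟨j, ?_, ?_⟩
    · simp [third]; grind
    · fin_cases t
      · simp [third]; grind
      · simp [third]; grind
      · simp [third]; grind
  · obtain ⟨j, h₁, h₂, h₃, h₄, h₅⟩ := avoid i i (i' - 1) i' (i' - 2)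
    refine ⟨j, ?_, ?_⟩
    · simp [third]; grind
    · fin_cases t
      · simp [third]; grind
      · simp [third]; grind
      · simp [third]; grind

theorem eq_zero_of_third_d (H : QuarticRelations Q) (hm : 6 ≤ m) [NeZero m]
    {w x y z : IndexedVar (ZMod m)} (hwx : third w x = none) (hyz : third y z = some (.inr ()))
    (hw : w ≠ .inr ()) (hx : x ≠ .inr ()) : Q w x y z = 0 := by
  obtain ⟨s, i⟩ | ⟨⟩ := w
  · obtain ⟨t, i'⟩ | ⟨⟩ := x
    -- In the exceptional order the two variables are interchanged, which leaves only four forbidden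
    -- values of `j`.
    · by_cases hst : s = 0 ∧ t = 1
      · rw [H.swap_left]
        exact H.eq_zero_of_third_d_aux hm (third_comm hm _ _ ▸ hwx) hyz (by simp [hst])
      · exact H.eq_zero_of_third_d_aux hm hwx hyz hst
    · exact absurd rfl hx
  · exact absurd rfl hw

theorem eq_zero_of_directZero (H : QuarticRelations Q) (hm : 6 ≤ m) [NeZero m] (l : ZMod m)
    {w x u : IndexedVar ℤ} {y z : IndexedVar (ZMod m)} (h : directZero w x u = true)
    (hwx : third (shift l w) (shift l x) = none) (hyz : third y z = some (shift l u)) :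
    Q (shift l w) (shift l x) y z = 0 := by
  obtain ⟨t, e⟩ | ⟨⟩ := u
  · simp only [directZero, Sum.isLeft_inl, if_true, List.any_eq_true] at h
    obtain ⟨q, hq, h⟩ := h
    rw [H.zero_congr hwx (hyz.trans (third_shift_of_mem_pairsOf hm l hq).symm)]
    exact H.eq_zero_of_zeroSplit hm l h
  · simp only [directZero, Sum.isLeft_inr, Bool.false_eq_true, if_false, Bool.and_eq_true] at h
    refine H.eq_zero_of_third_d hm hwx hyz ?_ ?_
    · obtain ⟨t, e⟩ | ⟨⟩ := w <;> simp at h ⊢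
    · obtain ⟨t, e⟩ | ⟨⟩ := x <;> simp at h ⊢

theorem eq_zero_of_directZeroPair (H : QuarticRelations Q) (hm : 6 ≤ m) [NeZero m] (l : ZMod m)
    {w x y z : IndexedVar ℤ} (h : directZeroPair w x y z = true) :
    Q (shift l w) (shift l x) (shift l y) (shift l z) = 0 := by
  simp only [directZeroPair, Bool.and_eq_true] at h
  obtain ⟨h₁, h₂⟩ := h
  split at h₂
  · next u hu =>
    exact H.eq_zero_of_directZero hm l h₂ (third_shift_of_nearZero hm l h₁) (third_shift hm l hu)
  · simp at h₂

theorem eq_zero_of_indirectZero (H : QuarticRelations Q) (hm : 6 ≤ m) [NeZero m] (l : ZMod m)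
    {w x u : IndexedVar ℤ} {y z : IndexedVar (ZMod m)} (h : indirectZero w x u = true)
    (hwx : third (shift l w) (shift l x) = none) (hyz : third y z = some (shift l u)) :
    Q (shift l w) (shift l x) y z = 0 := by
  simp only [indirectZero, List.any_eq_true, Bool.or_eq_true] at h
  obtain ⟨q, hq, h⟩ := h
  rw [H.zero_congr hwx (hyz.trans (third_shift_of_mem_pairsOf hm l hq).symm)]
  rcases h with ((h | h) | h) | h
  · rw [H.swap_mid]
    exact H.eq_zero_of_directZeroPair hm l h
  · rw [H.swap_mid, H.swap_pairs]
    exact H.eq_zero_of_directZeroPair hm l h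
  · rw [H.swap_right, H.swap_mid]
    exact H.eq_zero_of_directZeroPair hm l h
  · rw [H.swap_right, H.swap_mid, H.swap_pairs]
    exact H.eq_zero_of_directZeroPair hm l h

/-- A variable is either in the window around `l` or far away from `l`. -/
theorem mem_window_or_far (l : ZMod m) (x : IndexedVar (ZMod m)) :
    (∃ x' ∈ window, x = shift l x') ∨
      ∃ t i, x = .inl (t, i) ∧ ∀ e ∈ ([-2, -1, 0, 1, 2] : List ℤ), i ≠ l + (e : ZMod m) := by
  obtain ⟨t, i⟩ | ⟨⟩ := x
  · by_cases h : ∀ e ∈ ([-2, -1, 0, 1, 2] : List ℤ), i ≠ l + (e : ZMod m)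
    · exact Or.inr ⟨t, i, rfl, h⟩
    · push Not at h
      obtain ⟨e, he, rfl⟩ := h
      refine Or.inl ⟨.inl (t, e), ?_, rfl⟩
      simp only [window, List.mem_cons, List.mem_flatMap, List.mem_map]
      exact Or.inr ⟨t, by fin_cases t <;> simp, e, by simpa using he, rfl⟩
  · exact Or.inl ⟨.inr (), by simp [window], rfl⟩

/-- Collinear variables other than `d` have indices differing by at most 1, so distance from `l`
more than 2 excludes everything within 1 of `l`. -/
theorem third_of_far {l i : ZMod m} (hi : ∀ e ∈ ([-2, -1, 0, 1, 2] : List ℤ), i ≠ l + (e : ZMod m))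
    (t s : Fin 3) {e : ℤ} (he : e ∈ ([-1, 0, 1] : List ℤ)) :
    third (.inl (t, i)) (shift l (.inl (s, e))) = none := by
  simp only [List.mem_cons, List.not_mem_nil, or_false, forall_eq_or_imp, forall_eq, Int.cast_neg,
    Int.cast_ofNat, Int.cast_one, Int.cast_zero] at hi he
  rcases he with rfl | rfl | rfl <;> simp [third] <;> grind

/-- The first three entries of `pairsOf` are those without `d`, which may be collinear with a far
variable. -/
theorem window_far : (([0, 1, 2] : List (Fin 3)).all fun t => window.all fun x =>
    decide (x = .inl (t, 0)) || ((pairsOf (.inl (t, 0))).take 3).any fun q =>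
      nearZero x q.1 || nearZero x q.2) = true := by
  decide +kernel

theorem mem_take_pairsOf (l : ZMod m) {t s : Fin 3} {i : ZMod m}
    {q : IndexedVar ℤ × IndexedVar ℤ}
    (hi : ∀ e ∈ ([-2, -1, 0, 1, 2] : List ℤ), i ≠ l + (e : ZMod m))
    (hq : q ∈ (pairsOf (.inl (t, 0))).take 3) :
    third (.inl (s, i)) (shift l q.1) = none ∧ third (.inl (s, i)) (shift l q.2) = none := by
  simp only [pairsOf, List.cons_append, List.nil_append, List.take_succ_cons, List.take_zero,
    List.mem_cons, List.not_mem_nil, or_false] at hq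
  rcases hq with rfl | rfl | rfl <;> constructor <;> exact third_of_far hi _ _ (by simp)

/-- The far variable forms a zero pair with either member of a `d`-free pair, so it is enough that
`x` forms one with some member. -/
theorem eq_zero_of_far (H : QuarticRelations Q) (hm : 6 ≤ m) {l i : ZMod m} {s t : Fin 3}
    {x y z : IndexedVar (ZMod m)}
    (hi : ∀ e ∈ ([-2, -1, 0, 1, 2] : List ℤ), i ≠ l + (e : ZMod m))
    (hwx : third (.inl (s, i)) x = none) (hyz : third y z = some (.inl (t, l)))
    (hx : x ≠ .inl (t, l)) : Q (.inl (s, i)) x y z = 0 := by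
  have hl : (.inl (t, l) : IndexedVar (ZMod m)) = shift l (.inl (t, 0)) := by simp
  rw [hl] at hyz
  suffices ∃ q ∈ (pairsOf (.inl (t, 0))).take 3,
      third x (shift l q.1) = none ∨ third x (shift l q.2) = none by
    obtain ⟨q, hq, h⟩ := this
    rw [H.zero_congr hwx (hyz.trans
      (third_shift_of_mem_pairsOf hm l (List.mem_of_mem_take hq)).symm)]
    obtain ⟨h₁, h₂⟩ := mem_take_pairsOf l (s := s) hi hq
    rcases h with h | h
    · rw [H.swap_right, H.swap_mid]
      exact H.zero_zero h₂ h
    · rw [H.swap_mid]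
      exact H.zero_zero h₁ h
  obtain ⟨x', hx', rfl⟩ | ⟨s', i', rfl, hi'⟩ := mem_window_or_far l x
  · have := List.all_eq_true.1 (List.all_eq_true.1 window_far t (by fin_cases t <;> simp)) x' hx'
    simp only [Bool.or_eq_true, decide_eq_true_eq, List.any_eq_true] at this
    rcases this with rfl | ⟨q, hq, h⟩
    · exact absurd hl.symm hx
    · exact ⟨q, hq, h.imp (third_shift_of_nearZero hm l) (third_shift_of_nearZero hm l)⟩
  · have h₀ : (.inl (t + 1, 0), .inl (t + 2, 0)) ∈ (pairsOf (.inl (t, (0 : ℤ)))).take 3 := by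
      simp [pairsOf]
    exact ⟨_, h₀, Or.inl (mem_take_pairsOf l hi' h₀).1⟩

theorem window_near : (window.all fun w => window.all fun x => isNear w x) = true := by
  decide +kernel

theorem nearZero_of_third_shift (hm : 6 ≤ m) (l : ZMod m) {w x : IndexedVar ℤ} (hw : w ∈ window)
    (hx : x ∈ window) (h : third (shift l w) (shift l x) = none) : nearZero w x = true := by
  have hn := List.all_eq_true.1 (List.all_eq_true.1 window_near w hw) x hx
  rcases hu : third w x with _ | u
  · simp [nearZero, hn, hu]
  · simp [third_shift hm l hu] at h

theorem eq_zero_of_third_ne (H : QuarticRelations Q) (hm : 6 ≤ m) [NeZero m]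
    {w x y z u : IndexedVar (ZMod m)} (hwx : third w x = none) (hyz : third y z = some u)
    (hw : w ≠ u) (hx : x ≠ u) : Q w x y z = 0 := by
  obtain ⟨t, l⟩ | ⟨⟩ := u
  · have hl : (.inl (t, l) : IndexedVar (ZMod m)) = shift l (.inl (t, 0)) := by simp
    obtain ⟨w', hw', rfl⟩ | ⟨s, i, rfl, hi⟩ := mem_window_or_far l w
    · obtain ⟨x', hx', rfl⟩ | ⟨s, i, rfl, hi⟩ := mem_window_or_far l x
      · have := List.all_eq_true.1 (List.all_eq_true.1 (List.all_eq_true.1 window_zero t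
          (by fin_cases t <;> simp)) w' hw') x' hx'
        simp only [nearZero_of_third_shift hm l hw' hx' hwx, Bool.or_eq_true, decide_eq_true_eq,
          Bool.not_true, Bool.false_eq_true, false_or] at this
        rw [hl] at hyz
        rcases this with ((rfl | rfl) | h) | h
        · exact absurd hl.symm hw
        · exact absurd hl.symm hx
        · exact H.eq_zero_of_directZero hm l h hwx hyz
        · exact H.eq_zero_of_indirectZero hm l h hwx hyz
      · rw [H.swap_left]
        exact H.eq_zero_of_far hm hi (third_comm hm _ _ ▸ hwx) hyz hw
    · exact H.eq_zero_of_far hm hi hwx hyz hx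
  · exact H.eq_zero_of_third_d hm hwx hyz hw hx

/-! ### Zero pairs against a third variable inside the pair: propagation along monomials -/

/-- All products `w * x * q` vanish, where `q` has third variable `x`. -/
def Kills (Q : IndexedVar (ZMod m) → IndexedVar (ZMod m) → IndexedVar (ZMod m) →
    IndexedVar (ZMod m) → W) (w x : IndexedVar (ZMod m)) : Prop :=
  ∀ y z, third y z = some x → Q w x y z = 0

theorem Kills.of_base (H : QuarticRelations Q) {w x p q : IndexedVar (ZMod m)}
    (hwx : third w x = none) (hx : third p q = some x) (h : Q w x p q = 0) : Kills Q w x :=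
  fun y z hyz => by rw [H.zero_congr hwx (hyz.trans hx.symm), h]

/-- If `x * x' * p` is a monomial of `F'`, then `w * x * (x' * p) = w * x' * (x * p)` represents
both products, so vanishing passes from `x` to `x'`. -/
theorem Kills.step (H : QuarticRelations Q) {w x x' : IndexedVar (ZMod m)} (h : Kills Q w x)
    (p : IndexedVar (ZMod m)) (hwx' : third w x' = none) (hx : third x' p = some x)
    (hx' : third x p = some x') : Kills Q w x' :=
  Kills.of_base H hwx' hx' (by rw [H.swap_mid]; exact h _ _ hx)

theorem third_abc (s t : Fin 3) (i : ZMod m) (h : s ≠ t) :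
    third (.inl (s, i)) (.inl (t, i)) = some (.inl (-(s + t), i)) := by
  simp [third, h]

theorem third_sq (t : Fin 3) (i : ZMod m) :
    third (.inl (t, i)) (.inl (t, i)) = some (.inl (t, i - 1)) := by
  simp [third]

theorem third_succ (hm : 6 ≤ m) (t : Fin 3) (i : ZMod m) :
    third (.inl (t, i)) (.inl (t, i + 1)) = some (.inl (t, i + 1)) := by
  have := (add_one_ne_self hm i).symm
  simp [third, this]

theorem third_d_b (i : ZMod m) : third (.inr ()) (.inl (1, i + 1)) = some (.inl (0, i)) := by
  simp [third]

theorem third_d_a (i : ZMod m) : third (.inr ()) (.inl (0, i)) = some (.inl (1, i + 1)) := by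
  simp [third]

theorem Kills.up (H : QuarticRelations Q) (hm : 6 ≤ m) {w : IndexedVar (ZMod m)} {t : Fin 3}
    {i : ZMod m} (h : Kills Q w (.inl (t, i))) (hw : third w (.inl (t, i + 1)) = none) :
    Kills Q w (.inl (t, i + 1)) :=
  h.step H (.inl (t, i + 1)) hw (by rw [third_sq, add_sub_cancel_right]) (third_succ hm t i)

theorem Kills.same_index (H : QuarticRelations Q) {w : IndexedVar (ZMod m)} {s t : Fin 3}
    {i : ZMod m} (h : Kills Q w (.inl (s, i))) (hw : third w (.inl (t, i)) = none) (hst : s ≠ t) :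
    Kills Q w (.inl (t, i)) := by
  have key : ∀ s t : Fin 3, s ≠ t →
      t ≠ -(s + t) ∧ s ≠ -(s + t) ∧ -(t + -(s + t)) = s ∧ -(s + -(s + t)) = t := by decide
  obtain ⟨h₁, h₂, h₃, h₄⟩ := key s t hst
  exact h.step H (.inl (-(s + t), i)) hw (by rw [third_abc _ _ _ h₁, h₃])
    (by rw [third_abc _ _ _ h₂, h₄])

theorem third_index_eq (s t : Fin 3) (i j : ZMod m) (h : third (.inl (s, i)) (.inl (t, j)) = none) :
    j ≠ i := by
  rintro rfl
  by_cases hst : s = t <;> simp [third, hst] at h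

/-- Climbs the cycle of monomials `cⱼ * cⱼ₊₁²` from `i + 1`, stopping just before it returns to the
possibly collinear index `i`. -/
theorem kills_c_add (H : QuarticRelations Q) (hm : 6 ≤ m) {w : IndexedVar (ZMod m)} {i : ZMod m}
    (h : Kills Q w (.inl (2, i + 1)))
    (hw : ∀ j, j ≠ i → third w (.inl (2, j)) = none) :
    ∀ n : ℕ, n + 1 < m → Kills Q w (.inl (2, i + 1 + n))
  | 0, _ => by simpa using h
  | n + 1, hn => by
    have := (kills_c_add H hm h hw n (by omega)).up H hm (hw _ fun h₀ => ?_)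
    · simpa [add_assoc] using this
    · have : ((n + 2 : ℕ) : ZMod m) = 0 := by push_cast; linear_combination h₀
      rw [ZMod.natCast_eq_zero_iff] at this
      exact absurd (Nat.le_of_dvd (by omega) this) (by omega)

theorem kills_c (H : QuarticRelations Q) (hm : 6 ≤ m) [NeZero m] {w : IndexedVar (ZMod m)}
    {i : ZMod m} (h : Kills Q w (.inl (2, i + 1)))
    (hw : ∀ j, j ≠ i → third w (.inl (2, j)) = none) {j : ZMod m} (hj : j ≠ i) :
    Kills Q w (.inl (2, j)) := by
  have h₀ : ((j - (i + 1)).val : ZMod m) = j - (i + 1) := by simp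
  have := kills_c_add H hm h hw (j - (i + 1)).val ?_
  · rwa [h₀, add_sub_cancel] at this
  · have h₁ := ZMod.val_lt (j - (i + 1))
    by_contra h₂
    refine hj ?_
    have h₃ : (j - (i + 1)).val + 1 = m := by omega
    have h₄ := congrArg (Nat.cast : ℕ → ZMod m) h₃
    push_cast at h₄
    rw [h₀, ZMod.natCast_self] at h₄
    linear_combination h₄

/-- An `aᵢ` or `bᵢ` is collinear with no `cⱼ` except `cᵢ`, so the `c` cycle reaches every other
index, and `aⱼ * bⱼ * cⱼ` then reaches the other letters. -/
theorem kills_of_a_or_b (H : QuarticRelations Q) (hm : 6 ≤ m) [NeZero m] {s : Fin 3} (hs : s ≠ 2)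
    {i : ZMod m} {x : IndexedVar (ZMod m)} (hwx : third (.inl (s, i)) x = none) :
    Kills Q (.inl (s, i)) x := by
  have hc (j : ZMod m) (hj : j ≠ i) : third (.inl (s, i)) (.inl (2, j)) = none := by
    simp [third, hs, hj]
  have h₁ := hc _ (add_one_ne_self hm i).symm
  obtain ⟨t, j⟩ | ⟨⟩ := x
  · have hj := third_index_eq _ _ _ _ hwx
    have := kills_c H hm (Kills.of_base H h₁ (third_abc 0 1 (i + 1) (by simp)) (by
      rw [H.swap_mid, H.swap_right]; exact H.base s i)) hc hj
    by_cases ht : t = 2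
    · exact ht ▸ this
    · exact this.same_index H hwx (Ne.symm ht)
  · fin_cases s <;> simp [third] at hs hwx

/-- Here `cᵢ` is not collinear with `d`, so `d` serves as a hub: the monomials `aⱼ * bⱼ₊₁ * d` lead
from `aᵢ₊₁` to `d`, and from there to every `aⱼ` with `j ≠ i`. -/
theorem kills_of_c (H : QuarticRelations Q) (hm : 6 ≤ m)
    {i : ZMod m} {x : IndexedVar (ZMod m)} (hwx : third (.inl (2, i)) x = none) :
    Kills Q (.inl (2, i)) x := by
  have hab (s : Fin 3) (j : ZMod m) (hs : s ≠ 2) (hj : j ≠ i) :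
      third (.inl (2, i)) (.inl (s, j)) = none := by
    simp [third, hs.symm, hj]
  have h₁ := (add_one_ne_self hm i).symm
  have h_a := Kills.of_base H (hab 0 _ (by simp) h₁) (third_abc 1 2 (i + 1) (by simp)) (H.base 2 i)
  have h_d : Kills Q (.inl (2, i)) (.inr ()) :=
    h_a.step H (.inl (1, i + 1 + 1)) (by simp [third]) (third_d_b _) (third_d_pair hm _)
  have h_a' (j : ZMod m) (hj : j ≠ i) : Kills Q (.inl (2, i)) (.inl (0, j)) :=
    h_d.step H (.inl (1, j + 1)) (hab 0 j (by simp) hj) (third_d_pair hm _) (third_d_b _)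
  obtain ⟨t, j⟩ | ⟨⟩ := x
  · have := h_a' j (third_index_eq _ _ _ _ hwx)
    by_cases ht : t = 0
    · exact ht ▸ this
    · exact this.same_index H hwx (Ne.symm ht)
  · exact h_d

theorem kills_of_d (H : QuarticRelations Q) (hm : 6 ≤ m) [NeZero m]
    {x : IndexedVar (ZMod m)} (hwx : third (.inr ()) x = none) : Kills Q (.inr ()) x := by
  have hd (j : ZMod m) : third (.inr ()) (.inl (2, j)) = none := by simp [third]
  have h_c (j : ZMod m) : Kills Q (.inr ()) (.inl (2, j)) := by
    have h₀ := Kills.of_base H (hd 0) (third_abc 0 1 0 (by simp)) (by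
      rw [H.swap_mid, H.swap_right]; exact H.base_d)
    -- No `cⱼ` is collinear with `d`, but each use of `kills_c` omits one index: starting at `c₀`
    -- misses `-1`, which is reached by starting at `c₁`.
    by_cases hj : j = -1
    · have h₁ := h₀.up H hm (hd _)
      exact kills_c H hm (i := 0) h₁ (fun j _ => hd j) (by
        rintro rfl; exact add_one_ne_self hm (-1 : ZMod m) (by linear_combination -hj))
    · exact kills_c H hm (i := -1) (by simpa using h₀) (fun j _ => hd j) hj
  -- Propagation cannot reach `d` itself, since the other variables of its monomials are collinear
  -- with `d`. Instead exchange with `(d * a₀ - a₁ * c₁) * (d * b₁ - b₀ * c₀)`, whose other three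
  -- terms vanish.
  have h_d : Kills Q (.inr ()) (.inr ()) := by
    refine Kills.of_base H (by simp [third]) (third_d_pair hm 0) ?_
    have h1 := add_one_ne_self hm (0 : ZMod m)
    rw [H.swap_mid]
    have e := H.exchange (third_d_a 0 |>.trans (third_abc 0 2 (0 + 1) (by simp)).symm)
      (third_d_b 0 |>.trans (third_abc 1 2 0 (by simp)).symm)
    have e₁ : Q (.inl (0, 0 + 1)) (.inl (2, 0 + 1)) (.inl (1, 0)) (.inl (2, 0)) = 0 := by
      rw [H.swap_right, H.swap_mid]
      exact H.zero_zero (by simpa [third] using h1) (by simpa [third] using h1)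
    have e₂ : Q (.inr ()) (.inl (0, 0)) (.inl (1, 0)) (.inl (2, 0)) = 0 := H.base_d
    have e₃ : Q (.inl (0, 0 + 1)) (.inl (2, 0 + 1)) (.inr ()) (.inl (1, 0 + 1)) = 0 := by
      rw [H.swap_pairs, H.swap_right, H.swap_mid]
      exact h_c _ _ _ (third_abc 1 0 (0 + 1) (by simp))
    rwa [e₁, e₂, e₃, add_zero, add_zero] at e
  obtain ⟨t, j⟩ | ⟨⟩ := x
  · fin_cases t
    · simp [third] at hwx
    · simp [third] at hwx
    · exact h_c j
  · exact h_d

theorem kills (H : QuarticRelations Q) (hm : 6 ≤ m) [NeZero m]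
    {w x : IndexedVar (ZMod m)} (hwx : third w x = none) : Kills Q w x := by
  obtain ⟨t, j⟩ | ⟨⟩ := w
  · by_cases ht : t = 2
    · subst ht
      exact kills_of_c H hm hwx
    · exact kills_of_a_or_b H hm ht hwx
  · exact kills_of_d H hm hwx

/-! ### From products with a zero pair to all products of four variables -/

theorem eq_zero_of_third_eq_none (H : QuarticRelations Q) (hm : 6 ≤ m) [NeZero m]
    {w x : IndexedVar (ZMod m)} (hwx : third w x = none) (y z) : Q w x y z = 0 := by
  rcases hyz : third y z with _ | u
  · exact H.zero_zero hwx hyz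
  · by_cases hx : x = u
    · exact H.kills hm hwx y z (hx ▸ hyz)
    · by_cases hw : w = u
      · rw [H.swap_left]
        exact H.kills hm (third_comm hm _ _ ▸ hwx) y z (hw ▸ hyz)
      · exact H.eq_zero_of_third_ne hm hwx hyz hw hx

theorem eq_zero_of_hasZero (H : QuarticRelations Q) (hm : 6 ≤ m) [NeZero m] (l : ZMod m)
    {w x y z : IndexedVar ℤ} (h : hasZero w x y z = true) :
    Q (shift l w) (shift l x) (shift l y) (shift l z) = 0 := by
  simp only [hasZero, Bool.or_eq_true] at h
  rcases h with ((((h | h) | h) | h) | h) | h <;> replace h := third_shift_of_nearZero hm l h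
  · exact H.eq_zero_of_third_eq_none hm h _ _
  · rw [H.swap_mid]
    exact H.eq_zero_of_third_eq_none hm h _ _
  · rw [H.swap_right, H.swap_mid]
    exact H.eq_zero_of_third_eq_none hm h _ _
  · rw [H.swap_left, H.swap_mid]
    exact H.eq_zero_of_third_eq_none hm h _ _
  · rw [H.swap_left, H.swap_right, H.swap_mid]
    exact H.eq_zero_of_third_eq_none hm h _ _
  · rw [H.swap_pairs]
    exact H.eq_zero_of_third_eq_none hm h _ _

/-- Three of the four terms of the exchange relation satisfy `P` and vanish, hence so does the
fourth. -/
theorem eq_zero_of_exchange (H : QuarticRelations Q) (hm : 6 ≤ m) (l : ZMod m)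
    {P : IndexedVar ℤ → IndexedVar ℤ → IndexedVar ℤ → IndexedVar ℤ → Bool}
    (hP : ∀ w x y z, P w x y z = true → Q (shift l w) (shift l x) (shift l y) (shift l z) = 0)
    {w x y z : IndexedVar ℤ} (h : SmallTangent.exchange P w x y z = true) :
    Q (shift l w) (shift l x) (shift l y) (shift l z) = 0 := by
  unfold SmallTangent.exchange at h
  split at h
  · next u v hu hv =>
    simp only [List.any_eq_true, Bool.and_eq_true] at h
    obtain ⟨q, hq, r, hr, ⟨h₁, h₂⟩, h₃⟩ := h
    have e := H.exchange ((third_shift hm l hu).trans (third_shift_of_mem_pairsOf hm l hq).symm)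
      ((third_shift hm l hv).trans (third_shift_of_mem_pairsOf hm l hr).symm)
    rwa [hP _ _ _ _ h₁, hP _ _ _ _ h₂, hP _ _ _ _ h₃, add_zero, add_zero] at e
  · simp at h

theorem eq_zero_of_exchangeAny (H : QuarticRelations Q) (hm : 6 ≤ m) (l : ZMod m)
    {P : IndexedVar ℤ → IndexedVar ℤ → IndexedVar ℤ → IndexedVar ℤ → Bool}
    (hP : ∀ w x y z, P w x y z = true → Q (shift l w) (shift l x) (shift l y) (shift l z) = 0)
    (w x y z : IndexedVar ℤ) (h : exchangeAny P w x y z = true) :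
    Q (shift l w) (shift l x) (shift l y) (shift l z) = 0 := by
  simp only [exchangeAny, Bool.or_eq_true] at h
  rcases h with ((h | h) | h) | h
  · exact hP _ _ _ _ h
  · exact H.eq_zero_of_exchange hm l hP h
  · rw [H.swap_mid]
    exact H.eq_zero_of_exchange hm l hP h
  · rw [H.swap_right, H.swap_mid]
    exact H.eq_zero_of_exchange hm l hP h

theorem eq_zero_of_inl (H : QuarticRelations Q) (hm : 6 ≤ m) [NeZero m] (t : Fin 3) (l : ZMod m)
    (x y z : IndexedVar (ZMod m)) : Q (.inl (t, l)) x y z = 0 := by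
  have hl : (.inl (t, l) : IndexedVar (ZMod m)) = shift l (.inl (t, 0)) := by simp
  have far {s : Fin 3} {i : ZMod m}
      (hi : ∀ e ∈ ([-2, -1, 0, 1, 2] : List ℤ), i ≠ l + (e : ZMod m)) (y z) :
      Q (.inl (t, l)) (.inl (s, i)) y z = 0 := by
    rw [H.swap_left, hl]
    exact H.eq_zero_of_third_eq_none hm (third_of_far hi _ _ (by simp)) _ _
  obtain ⟨x', hx', rfl⟩ | ⟨s, i, rfl, hi⟩ := mem_window_or_far l x
  · obtain ⟨y', hy', rfl⟩ | ⟨s, i, rfl, hi⟩ := mem_window_or_far l y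
    · obtain ⟨z', hz', rfl⟩ | ⟨s, i, rfl, hi⟩ := mem_window_or_far l z
      · have := List.all_eq_true.1 (List.all_eq_true.1 (List.all_eq_true.1 (List.all_eq_true.1
          window_clique t (by fin_cases t <;> simp)) x' hx') y' hy') z' hz'
        rw [hl]
        exact H.eq_zero_of_exchangeAny hm l (H.eq_zero_of_exchangeAny hm l fun _ _ _ _ =>
          H.eq_zero_of_hasZero hm l) _ _ _ _ this
      · rw [H.swap_right, H.swap_mid]
        exact far hi _ _
    · rw [H.swap_mid]
      exact far hi _ _
  · exact far hi _ _

/-- The relations force all products of four variables to vanish. -/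
theorem eq_zero (H : QuarticRelations Q) (hm : 6 ≤ m) [NeZero m] (w x y z : IndexedVar (ZMod m)) :
    Q w x y z = 0 := by
  obtain ⟨t, l⟩ | ⟨⟩ := w
  · exact H.eq_zero_of_inl hm t l x y z
  · obtain ⟨t, l⟩ | ⟨⟩ := x
    · rw [H.swap_left]
      exact H.eq_zero_of_inl hm t l _ _ _
    · exact H.eq_zero_of_third_eq_none hm (by simp [third]) _ _

end QuarticRelations
end Vanishing

open MvPolynomial

/-! ### The monomials of the cubic and its dual functional -/

section Monomials

theorem pair_eq_pair {α : Type*} {q r y z : α} (h : ({q, r} : Multiset α) = {y, z}) :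
    (q = y ∧ r = z) ∨ (q = z ∧ r = y) := by
  simp only [Multiset.insert_eq_cons, Multiset.cons_eq_cons, Multiset.singleton_inj] at h
  rcases h with h | ⟨_, cs, h₁, h₂⟩
  · exact Or.inl h
  · rw [Multiset.singleton_eq_cons_iff] at h₁ h₂
    obtain ⟨rfl, rfl⟩ := h₁
    exact Or.inr ⟨h₂.1.symm, rfl⟩

/-- The monomials of the cubic `F'`, as multisets of variables. -/
def triple {m : ℕ} : Fin 5 × ZMod m → Multiset (Var m)
  | (0, i) => {.inl (0, i), .inl (1, i), .inl (2, i)}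
  | (1, i) => {.inl (0, i), .inl (0, i + 1), .inl (0, i + 1)}
  | (2, i) => {.inl (1, i), .inl (1, i + 1), .inl (1, i + 1)}
  | (3, i) => {.inl (2, i), .inl (2, i + 1), .inl (2, i + 1)}
  | (4, i) => {.inl (0, i), .inl (1, i + 1), .inr ()}

variable {m : ℕ}

theorem third_of_triple_eq {p q r v y z : Var m} (hm : 6 ≤ m)
    (h : ({p, q, r} : Multiset (Var m)) = {v, y, z}) (hp : third q r = some p)
    (hq : third p r = some q) (hr : third p q = some r) : third y z = some v := by
  have hv : v ∈ ({p, q, r} : Multiset (Var m)) := by rw [h]; simp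
  simp only [Multiset.insert_eq_cons, Multiset.mem_cons, Multiset.mem_singleton] at hv
  have aux {p q r : Var m} (h : ({p, q, r} : Multiset (Var m)) = {p, y, z})
      (hp : third q r = some p) : third y z = some p := by
    rcases pair_eq_pair ((Multiset.cons_inj_right _).1 h) with ⟨rfl, rfl⟩ | ⟨rfl, rfl⟩
    · exact hp
    · rwa [third_comm hm]
  rcases hv with rfl | rfl | rfl
  · exact aux h hp
  · exact aux ((Multiset.cons_swap _ _ _).trans h) hq
  · refine aux (q := p) (r := q) (Eq.trans ?_ h) hr
    simp only [Multiset.insert_eq_cons, ← Multiset.singleton_add]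
    abel

theorem third_of_triple (hm : 6 ≤ m) {x : Fin 5 × ZMod m} {v y z : Var m}
    (h : triple x = {v, y, z}) : third y z = some v := by
  have h2 := QuarticRelations.third_succ hm
  obtain ⟨τ, i⟩ := x
  have e' := (add_one_ne_self hm i).symm
  fin_cases τ
  · exact third_of_triple_eq hm h (by simp [third]) (by simp [third]; rfl)
      (by simp [third]; rfl)
  · exact third_of_triple_eq hm h (by simp [third]) (h2 _ _) (h2 _ _)
  · exact third_of_triple_eq hm h (by simp [third]) (h2 _ _) (h2 _ _)
  · exact third_of_triple_eq hm h (by simp [third]) (h2 _ _) (h2 _ _)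
  · exact third_of_triple_eq hm h (by simp [third]) (by simp [third]) (by simp [third, e'])

theorem triple_succ (s : Fin 3) (i : ZMod m) : triple (s.succ.castSucc, i) =
    {.inl (s, i), .inl (s, i + 1), .inl (s, i + 1)} := by
  fin_cases s <;> rfl

theorem exists_triple {v y z : Var m} (h : third y z = some v) :
    ∃ x, triple x = {v, y, z} := by
  obtain ⟨s, i⟩ | ⟨⟩ := y <;> obtain ⟨t, j⟩ | ⟨⟩ := z
  · simp only [third] at h
    split_ifs at h with c₁ c₂ c₃ c₄ c₅ c₆ c₇ <;> obtain rfl := Option.some.inj h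
    · subst c₁ c₂
      refine ⟨(s.succ.castSucc, j - 1), ?_⟩
      rw [triple_succ, sub_add_cancel]
    · subst c₁ c₃
      refine ⟨(s.succ.castSucc, i), ?_⟩
      simp only [triple_succ, Multiset.insert_eq_cons, ← Multiset.singleton_add]
      abel
    · subst c₁ c₄
      refine ⟨(s.succ.castSucc, j), ?_⟩
      simp only [triple_succ, Multiset.insert_eq_cons, ← Multiset.singleton_add]
      abel
    · subst c₅
      refine ⟨(0, j), ?_⟩
      have key : ∀ s t : Fin 3, s ≠ t → ({0, 1, 2} : Multiset (Fin 3)) = {-(s + t), s, t} := by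
        decide
      have := congrArg (Multiset.map fun t => (.inl (t, j) : Var m)) (key s t c₁)
      simpa [triple] using this
    · obtain ⟨rfl, rfl, rfl⟩ := c₆
      refine ⟨(4, i), ?_⟩
      simp only [Multiset.insert_eq_cons, ← Multiset.singleton_add, triple]
      abel
    · obtain ⟨rfl, rfl, rfl⟩ := c₇
      refine ⟨(4, j), ?_⟩
      simp only [Multiset.insert_eq_cons, ← Multiset.singleton_add, triple]
      abel
  · simp only [third] at h
    split_ifs at h with c₁ c₂ <;> obtain rfl := Option.some.inj h
    · subst c₁
      refine ⟨(4, i), ?_⟩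
      simp only [Multiset.insert_eq_cons, ← Multiset.singleton_add, triple]
      abel
    · subst c₂
      refine ⟨(4, i - 1), ?_⟩
      simp only [Multiset.insert_eq_cons, ← Multiset.singleton_add, triple, sub_add_cancel]
  · simp only [third] at h
    split_ifs at h with c₁ c₂ <;> obtain rfl := Option.some.inj h
    · subst c₁
      refine ⟨(4, j), ?_⟩
      simp only [Multiset.insert_eq_cons, ← Multiset.singleton_add, triple]
      abel
    · subst c₂
      refine ⟨(4, j - 1), ?_⟩
      simp only [Multiset.insert_eq_cons, ← Multiset.singleton_add, triple, sub_add_cancel]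
      abel
  · simp [third] at h

/-- Distinctness of the monomials makes every coefficient of the cubic exactly 1, whatever the
characteristic. -/
theorem triple_injective (hm : 6 ≤ m) : Function.Injective (triple (m := m)) := by
  rintro ⟨τ, i⟩ ⟨τ', j⟩ h
  let letter : Var m → Fin 4 := Sum.elim (fun p => p.1.castSucc) fun _ => 3
  -- The letters alone determine the family; they do not depend on the index, so `ZMod 6` is only a
  -- concrete model in which this is decidable.
  have key : ∀ τ τ' : Fin 5, ((triple (τ, (0 : ZMod 6))).map
      (Sum.elim (fun p => p.1.castSucc) fun _ => 3 : Var 6 → Fin 4)) =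
      ((triple (τ', (0 : ZMod 6))).map
      (Sum.elim (fun p => p.1.castSucc) fun _ => 3 : Var 6 → Fin 4)) → τ = τ' := by decide
  have hl (τ : Fin 5) (i : ZMod m) : (triple (τ, i)).map letter = (triple (τ, (0 : ZMod 6))).map
      (Sum.elim (fun p => p.1.castSucc) fun _ => 3 : Var 6 → Fin 4) := by
    fin_cases τ <;> rfl
  obtain rfl := key τ τ' (by rw [← hl τ i, ← hl τ' j, h])
  have e1 := add_one_ne_self hm i
  -- Excludes `j = i + 1` together with `i = j + 1`, the only other way for the memberships to agree
  -- in a family of monomials with a square.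
  have e2 := add_one_add_one_ne_self hm i
  have hp := fun p : Var m => congrArg (p ∈ ·) h
  have h₁ := hp (.inl (0, i))
  have h₂ := hp (.inl (0, j))
  have h₃ := hp (.inl (1, i))
  have h₄ := hp (.inl (1, j))
  have h₅ := hp (.inl (2, i))
  have h₆ := hp (.inl (2, j))
  fin_cases τ <;> simp [triple] at h₁ h₂ h₃ h₄ h₅ h₆ ⊢ <;> grind

/-- The product of the variables in a multiset. -/
noncomputable def monom {σ : Type*} (k : Type*) [Field k] (s : Multiset σ) : MvPolynomial σ k :=
  (s.map X).prod

theorem monom_eq_monomial {σ : Type*} [DecidableEq σ] (k : Type*) [Field k] (s : Multiset σ) :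
    monom k s = monomial (Multiset.toFinsupp s) 1 := by
  induction s using Multiset.induction with
  | empty => simp [monom]
  | cons a s ih =>
    rw [monom, Multiset.map_cons, Multiset.prod_cons, ← monom, ih, ← Multiset.singleton_add,
      map_add, Multiset.toFinsupp_singleton, X, monomial_mul, one_mul]

theorem degree_toFinsupp {σ : Type*} [DecidableEq σ] (s : Multiset σ) :
    (Multiset.toFinsupp s).degree = Multiset.card s := by
  induction s using Multiset.induction with
  | empty => simp
  | cons a s ih =>
    rw [← Multiset.singleton_add, map_add, map_add, ih, Multiset.toFinsupp_singleton,
      Finsupp.degree_single, Multiset.card_add, Multiset.card_singleton]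

variable (k : Type*) [Field k] (m)

theorem cubicF'_eq_sum [NeZero m] : cubicF' k m = ∑ x : Fin 5 × ZMod m, monom k (triple x) := by
  rw [Fintype.sum_prod_type, Fin.sum_univ_five]
  simp only [← Finset.sum_add_distrib, cubicF', cubicF]
  refine Finset.sum_congr rfl fun i _ => ?_
  simp only [monom, triple, Multiset.insert_eq_cons, Multiset.map_cons, Multiset.map_singleton,
    Multiset.prod_cons, Multiset.prod_singleton, a, b, c, d]
  ring

theorem dualElement_monom {σ : Type*} [DecidableEq σ] (s : Multiset σ) :
    dualElement (monom k s) = dualMonomial (k := k) (Multiset.toFinsupp s) := by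
  have := (basisMonomials σ k).constr_basis k (dualMonomial (k := k)) (Multiset.toFinsupp s)
  rw [coe_basisMonomials] at this
  rw [monom_eq_monomial]
  exact this

/-- The dual element of the cubic `F'`, as a functional on the polynomial ring. -/
noncomputable def dualCubic [NeZero m] : MvPolynomial (Var m) k →ₗ[k] k :=
  (dualElement (cubicF' k m)).1

theorem dualCubic_apply [NeZero m] (p : MvPolynomial (Var m) k) :
    dualCubic m k p = ∑ x : Fin 5 × ZMod m, coeff (Multiset.toFinsupp (triple x)) p := by
  simp only [dualCubic, cubicF'_eq_sum, map_sum, dualElement_monom]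
  simp [dualMonomial]

theorem card_triple {m : ℕ} (x : Fin 5 × ZMod m) : Multiset.card (triple x) = 3 := by
  obtain ⟨τ, i⟩ := x
  fin_cases τ <;> rfl

theorem isHomogeneousOfDegree_dualElement [NeZero m] :
    IsHomogeneousOfDegree (dualElement (cubicF' k m)) 3 := by
  simp only [cubicF'_eq_sum, map_sum, dualElement_monom]
  exact Submodule.sum_mem _ fun x _ => Submodule.subset_span
    ⟨_, by rw [degree_toFinsupp, card_triple], rfl⟩

variable {k m}

theorem dualCubic_eq_zero [NeZero m] {p : MvPolynomial (Var m) k} {n : ℕ} (hp : p.IsHomogeneous n)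
    (hn : n ≠ 3) : dualCubic m k p = 0 := by
  rw [dualCubic_apply]
  exact Finset.sum_eq_zero fun x _ => hp.coeff_eq_zero (by
    rw [degree_toFinsupp, card_triple]; exact hn.symm)

theorem dualCubic_X_mul_X_mul_X [NeZero m] (hm : 6 ≤ m) (v y z : Var m) :
    dualCubic m k (X v * X y * X z) = if third y z = some v then 1 else 0 := by
  have h : (X v * X y * X z : MvPolynomial (Var m) k) = monom k {v, y, z} := by
    simp [monom, mul_assoc]
  simp only [h, dualCubic_apply, monom_eq_monomial, coeff_monomial,
    Multiset.toFinsupp.injective.eq_iff]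
  split_ifs with hv
  · obtain ⟨x, hx⟩ := exists_triple hv
    rw [← hx, Finset.sum_eq_single x (fun x' _ hne => if_neg fun h =>
      hne (triple_injective hm h).symm) (by simp), if_pos rfl]
  · exact Finset.sum_eq_zero fun x _ => if_neg fun h => hv (third_of_triple hm h.symm)

end Monomials

/-! ### Criteria for Hilbert functions -/

section Hilbert

variable {σ k : Type*} [Field k]

theorem mem_Ann {f : dividedPower σ k} {s : MvPolynomial σ k} :
    s ∈ Ann f ↔ ∀ t, f.1 (s * t) = 0 :=
  ⟨fun h t => LinearMap.congr_fun (Subtype.ext_iff.1 h) t,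
    fun h => Subtype.ext (LinearMap.ext fun t => h t)⟩

theorem homogeneousSubmodule_succ_le {N : Submodule k (MvPolynomial σ k)} {n : ℕ}
    (h : ∀ v, ∀ q ∈ homogeneousSubmodule σ k n, X v * q ∈ N) :
    homogeneousSubmodule σ k (n + 1) ≤ N := by
  classical
  intro p hp
  rw [p.as_sum]
  refine N.sum_mem fun s hs => ?_
  have hd : s.degree = n + 1 := by
    by_contra hne
    exact mem_support_iff.1 hs (IsHomogeneous.coeff_eq_zero hp hne)
  have hs0 : s ≠ 0 := by
    rintro rfl
    simp at hd
  obtain ⟨v, hv⟩ := Finsupp.ne_iff.1 hs0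
  have hle : Finsupp.single v 1 ≤ s := by
    simpa [Nat.one_le_iff_ne_zero] using hv
  have hX : monomial s (coeff s p) =
      X v * monomial (s - Finsupp.single v 1) (coeff s p) := by
    rw [X, monomial_mul, one_mul, add_tsub_cancel_of_le hle]
  rw [hX]
  refine h v _ (isHomogeneous_monomial _ ?_)
  have := congrArg Finsupp.degree (add_tsub_cancel_of_le hle)
  rw [map_add, Finsupp.degree_single] at this
  omega

theorem homogeneousSubmodule_zero_le {N : Submodule k (MvPolynomial σ k)} (h : 1 ∈ N) :
    homogeneousSubmodule σ k 0 ≤ N := by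
  intro p hp
  rw [totalDegree_eq_zero_iff_eq_C.1 ((totalDegree_zero_iff_isHomogeneous σ).2 hp), C_eq_smul_one]
  exact N.smul_mem _ h

theorem homogeneousSubmodule_one_le {N : Submodule k (MvPolynomial σ k)} (h : ∀ v, X v ∈ N) :
    homogeneousSubmodule σ k 1 ≤ N :=
  homogeneousSubmodule_succ_le fun v _ hq => homogeneousSubmodule_zero_le
    (N := N.comap (LinearMap.mulLeft k (X v))) (by simpa using h v) hq

theorem homogeneousSubmodule_two_le {N : Submodule k (MvPolynomial σ k)}
    (h : ∀ x y, X x * X y ∈ N) : homogeneousSubmodule σ k 2 ≤ N :=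
  homogeneousSubmodule_succ_le fun v _ hq => homogeneousSubmodule_one_le
    (N := N.comap (LinearMap.mulLeft k (X v))) (h v) hq

theorem homogeneousSubmodule_three_le {N : Submodule k (MvPolynomial σ k)}
    (h : ∀ x y z, X x * (X y * X z) ∈ N) : homogeneousSubmodule σ k 3 ≤ N :=
  homogeneousSubmodule_succ_le fun v _ hq => homogeneousSubmodule_two_le
    (N := N.comap (LinearMap.mulLeft k (X v))) (h v) hq

theorem homogeneousSubmodule_four_le {N : Submodule k (MvPolynomial σ k)}
    (h : ∀ w x y z, X w * (X x * (X y * X z)) ∈ N) : homogeneousSubmodule σ k 4 ≤ N :=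
  homogeneousSubmodule_succ_le fun v _ hq => homogeneousSubmodule_three_le
    (N := N.comap (LinearMap.mulLeft k (X v)))
    (fun x y z => Submodule.mem_comap.2 (h v x y z)) hq

/-- The quotient map as a `k`-linear map. -/
noncomputable def quot (J : Ideal (MvPolynomial σ k)) :
    MvPolynomial σ k →ₗ[k] MvPolynomial σ k ⧸ J :=
  (Ideal.Quotient.mkₐ k J).toLinearMap

theorem quot_eq_zero {J : Ideal (MvPolynomial σ k)} {p : MvPolynomial σ k} :
    quot J p = 0 ↔ p ∈ J :=
  Ideal.Quotient.eq_zero_iff_mem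

theorem hilbertFunction_eq_zero {J : Ideal (MvPolynomial σ k)} {n : ℕ}
    (h : ∀ p ∈ homogeneousSubmodule σ k n, p ∈ J) : hilbertFunction J n = 0 := by
  have : gradedPart J n = ⊥ := by
    exact eq_bot_iff.2 (Submodule.map_le_iff_le_comap.2 fun p hp => quot_eq_zero.2 (h p hp))
  rw [hilbertFunction, this, finrank_bot]

/-- The functionals `f` descend to the quotient and are dual to the spanning classes, which are
therefore independent. -/
theorem hilbertFunction_eq_card {ι : Type*} [Fintype ι] [DecidableEq ι]
    {J : Ideal (MvPolynomial σ k)} {n : ℕ} (s : ι → MvPolynomial σ k)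
    (hs : ∀ v, s v ∈ homogeneousSubmodule σ k n)
    (hspan : homogeneousSubmodule σ k n ≤
      (Submodule.span k (Set.range fun v => quot J (s v))).comap (quot J))
    (f : ι → MvPolynomial σ k →ₗ[k] k) (hf : ∀ v, ∀ p ∈ J, f v p = 0)
    (hfs : ∀ v w, f v (s w) = if v = w then 1 else 0) :
    hilbertFunction J n = Fintype.card ι := by
  have hg : gradedPart J n = Submodule.span k (Set.range fun v => quot J (s v)) := by
    refine le_antisymm (Submodule.map_le_iff_le_comap.2 hspan) (Submodule.span_le.2 ?_)
    rintro _ ⟨v, rfl⟩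
    exact Submodule.mem_map_of_mem (hs v)
  rw [hilbertFunction, hg]
  refine finrank_span_eq_card (Fintype.linearIndependent_iff.2 fun c hc v => ?_)
  have h0 : ∑ w, c w • s w ∈ J := by
    rw [← quot_eq_zero, map_sum]
    simpa using hc
  simpa [hfs] using hf v _ h0

end Hilbert

/-! ### The apolar ideal and the Hilbert function of the apolar algebra -/

section Apolar

variable {k : Type*} [Field k] {m : ℕ} [NeZero m]

/-- The apolar ideal of the cubic `F'`. -/
noncomputable abbrev apolarIdeal (m : ℕ) [NeZero m] (k : Type*) [Field k] :
    Ideal (MvPolynomial (Var m) k) :=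
  Ann (dualElement (cubicF' k m))

theorem mem_apolarIdeal {s : MvPolynomial (Var m) k} :
    s ∈ apolarIdeal m k ↔ ∀ t, dualCubic m k (s * t) = 0 :=
  mem_Ann

/-- The dual cubic vanishes outside degree 3, so only cofactors of the complementary degree matter.
-/
theorem mem_apolarIdeal_of_isHomogeneous {q : MvPolynomial (Var m) k} {i j : ℕ} (hij : i + j = 3)
    (hq : q.IsHomogeneous i)
    (h : ∀ t ∈ homogeneousSubmodule (Var m) k j, dualCubic m k (q * t) = 0) :
    q ∈ apolarIdeal m k := by
  refine mem_apolarIdeal.2 fun t => ?_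
  rw [← sum_homogeneousComponent t, Finset.mul_sum, map_sum]
  refine Finset.sum_eq_zero fun l _ => ?_
  by_cases hl : l = j
  · subst hl
    exact h _ (homogeneousComponent_isHomogeneous _ _)
  · exact dualCubic_eq_zero (hq.mul (homogeneousComponent_isHomogeneous l t)) (by omega)

theorem quadric_mem_apolarIdeal {q : MvPolynomial (Var m) k} (hq : q.IsHomogeneous 2)
    (h : ∀ v, dualCubic m k (X v * q) = 0) : q ∈ apolarIdeal m k :=
  mem_apolarIdeal_of_isHomogeneous (i := 2) (j := 1) rfl hq (homogeneousSubmodule_one_le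
    (N := LinearMap.ker (dualCubic m k ∘ₗ LinearMap.mulLeft k q)) fun v => by
      simpa [mul_comm q] using h v)

theorem cubic_mem_apolarIdeal {q : MvPolynomial (Var m) k} (hq : q.IsHomogeneous 3)
    (h : dualCubic m k q = 0) : q ∈ apolarIdeal m k :=
  mem_apolarIdeal_of_isHomogeneous (i := 3) (j := 0) rfl hq (homogeneousSubmodule_zero_le
    (N := LinearMap.ker (dualCubic m k ∘ₗ LinearMap.mulLeft k q)) (by simpa using h))

theorem mem_apolarIdeal_of_four_le {q : MvPolynomial (Var m) k} {i : ℕ} (hi : 4 ≤ i)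
    (hq : q.IsHomogeneous i) : q ∈ apolarIdeal m k := by
  refine mem_apolarIdeal.2 fun t => ?_
  rw [← sum_homogeneousComponent t, Finset.mul_sum, map_sum]
  exact Finset.sum_eq_zero fun l _ =>
    dualCubic_eq_zero (hq.mul (homogeneousComponent_isHomogeneous l t)) (by omega)

theorem dualCubic_X_mul (hm : 6 ≤ m) (v y z : Var m) :
    dualCubic m k (X v * (X y * X z)) = if third y z = some v then 1 else 0 := by
  rw [← mul_assoc, dualCubic_X_mul_X_mul_X hm]

theorem X_mul_X_isHomogeneous {σ : Type*} (x y : σ) :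
    (X x * X y : MvPolynomial σ k).IsHomogeneous 2 :=
  (isHomogeneous_X k x).mul (isHomogeneous_X k y)

theorem X_mul_X_mul_X_isHomogeneous {σ : Type*} (x y z : σ) :
    (X x * (X y * X z) : MvPolynomial σ k).IsHomogeneous 3 :=
  (isHomogeneous_X k x).mul (X_mul_X_isHomogeneous y z)

theorem X_mul_X_mem_apolarIdeal (hm : 6 ≤ m) {y z : Var m} (h : third y z = none) :
    (X y * X z : MvPolynomial (Var m) k) ∈ apolarIdeal m k :=
  quadric_mem_apolarIdeal (X_mul_X_isHomogeneous y z) fun v => by simp [dualCubic_X_mul hm, h]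

theorem X_mul_X_sub_mem_apolarIdeal (hm : 6 ≤ m) {y z y' z' : Var m}
    (h : third y z = third y' z') :
    (X y * X z - X y' * X z' : MvPolynomial (Var m) k) ∈ apolarIdeal m k :=
  quadric_mem_apolarIdeal ((X_mul_X_isHomogeneous y z).sub (X_mul_X_isHomogeneous y' z'))
    fun v => by simp [mul_sub, dualCubic_X_mul hm, h]

/-- A pair of variables with the given third variable. -/
def somePair {m : ℕ} : Var m → Var m × Var m
  | .inl (t, i) => (.inl (t, i + 1), .inl (t, i + 1))
  | .inr _ => (.inl (0, 0), .inl (1, 0 + 1))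

omit [NeZero m] in
theorem third_somePair (hm : 6 ≤ m) (v : Var m) :
    third (somePair v).1 (somePair v).2 = some v := by
  obtain ⟨t, i⟩ | ⟨⟩ := v
  · simp [somePair, third]
  · exact QuarticRelations.third_d_pair hm 0

theorem hilbert_zero (hm : 6 ≤ m) : hilbertFunction (apolarIdeal m k) 0 = 1 := by
  refine (hilbertFunction_eq_card (ι := Unit) (fun _ => 1) (fun _ => isHomogeneous_one _ _)
    (homogeneousSubmodule_zero_le (Submodule.subset_span ⟨(), rfl⟩))
    (fun _ => dualCubic m k ∘ₗ LinearMap.mulRight k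
      (X (.inr ()) * (X (somePair (.inr ())).1 * X (somePair (.inr ())).2)))
    (fun _ p hp => mem_apolarIdeal.1 hp _) fun _ _ => ?_).trans Fintype.card_unit
  simp [← mul_assoc, dualCubic_X_mul_X_mul_X hm, third_somePair hm]

theorem hilbert_one (hm : 6 ≤ m) :
    hilbertFunction (apolarIdeal m k) 1 = Fintype.card (Var m) := by
  refine hilbertFunction_eq_card X (isHomogeneous_X k)
    (homogeneousSubmodule_one_le fun v => Submodule.subset_span ⟨v, rfl⟩)
    (fun v => dualCubic m k ∘ₗ LinearMap.mulRight k (X (somePair v).1 * X (somePair v).2))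
    (fun _ p hp => mem_apolarIdeal.1 hp _) fun v w => ?_
  simp [dualCubic_X_mul_X_mul_X hm, third_somePair hm]

theorem hilbert_two (hm : 6 ≤ m) :
    hilbertFunction (apolarIdeal m k) 2 = Fintype.card (Var m) := by
  refine hilbertFunction_eq_card (fun v => X (somePair v).1 * X (somePair v).2)
    (fun v => X_mul_X_isHomogeneous _ _) (homogeneousSubmodule_two_le fun x y => ?_)
    (fun v => dualCubic m k ∘ₗ LinearMap.mulLeft k (X v))
    (fun v p hp => by simpa [mul_comm] using mem_apolarIdeal.1 hp (X v)) fun v w => ?_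
  · rw [Submodule.mem_comap]
    rcases h : third x y with _ | v
    · rw [quot_eq_zero.2 (X_mul_X_mem_apolarIdeal hm h)]
      exact Submodule.zero_mem _
    · have := X_mul_X_sub_mem_apolarIdeal (k := k) hm (h.trans (third_somePair hm v).symm)
      rw [← quot_eq_zero, map_sub, sub_eq_zero] at this
      rw [this]
      exact Submodule.subset_span ⟨v, rfl⟩
  · simp [dualCubic_X_mul hm, third_somePair hm, eq_comm]

theorem hilbert_three (hm : 6 ≤ m) : hilbertFunction (apolarIdeal m k) 3 = 1 := by
  set s : MvPolynomial (Var m) k :=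
    X (.inr ()) * (X (somePair (.inr ())).1 * X (somePair (.inr ())).2) with hs
  have h1 : dualCubic m k s = 1 := by simp [hs, dualCubic_X_mul hm, third_somePair hm]
  have hs3 : s.IsHomogeneous 3 := X_mul_X_mul_X_isHomogeneous _ _ _
  refine (hilbertFunction_eq_card (ι := Unit) (fun _ => s) (fun _ => hs3) (fun p hp => ?_)
    (fun _ => dualCubic m k) (fun _ p hp => by simpa using mem_apolarIdeal.1 hp 1)
    fun _ _ => by simp [h1]).trans Fintype.card_unit
  have h : p - dualCubic m k p • s ∈ apolarIdeal m k :=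
    cubic_mem_apolarIdeal (Submodule.sub_mem _ hp (Submodule.smul_mem _ _ hs3)) (by simp [h1])
  rw [← quot_eq_zero, map_sub, map_smul, sub_eq_zero] at h
  rw [Submodule.mem_comap, h]
  exact Submodule.smul_mem _ _ (Submodule.subset_span ⟨(), rfl⟩)

theorem hilbert_ge_four (i : ℕ) (hi : 4 ≤ i) : hilbertFunction (apolarIdeal m k) i = 0 :=
  hilbertFunction_eq_zero fun _ hp => mem_apolarIdeal_of_four_le hi hp

/-! ### The square of the apolar ideal -/

/-- The functional on quartics obtained by differentiating and applying the dual cubic. -/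
noncomputable def tangent (m : ℕ) [NeZero m] (k : Type*) [Field k] (v : Var m) :
    MvPolynomial (Var m) k →ₗ[k] k :=
  dualCubic m k ∘ₗ (pderiv v).toLinearMap

/-- By Leibniz, the derivative of `p * q` is again in the apolar ideal. -/
theorem tangent_mul_eq_zero (v : Var m) {p q : MvPolynomial (Var m) k}
    (hp : p ∈ apolarIdeal m k) (hq : q ∈ apolarIdeal m k) : tangent m k v (p * q) = 0 := by
  have h1 := mem_apolarIdeal.1 hp (pderiv v q)
  have h2 := mem_apolarIdeal.1 hq (pderiv v p)
  simp [tangent, Derivation.leibniz, h1, h2]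

theorem tangent_eq_zero (v : Var m) {p : MvPolynomial (Var m) k}
    (hp : p ∈ (apolarIdeal m k) ^ 2) : tangent m k v p = 0 := by
  rw [pow_two] at hp
  refine Submodule.mul_induction_on hp (fun p hp q hq => tangent_mul_eq_zero v hp hq) ?_
  intro p q hp hq
  rw [map_add, hp, hq, add_zero]

/-- The monomial `v * aⱼ * bⱼ * cⱼ`. -/
noncomputable def quartic (k : Type*) [Field k] {m : ℕ} (v : Var m) (j : ZMod m) :
    MvPolynomial (Var m) k :=
  X v * (X (.inl (0, j)) * (X (.inl (1, j)) * X (.inl (2, j))))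

/-- Differentiating by `w` leaves the monomial `aⱼ * bⱼ * cⱼ` of `F'`; differentiating by one of
these three leaves `w` times a pair whose third variable is not `w`. -/
theorem tangent_quartic (hm : 6 ≤ m) (v w : Var m) (j : ZMod m) (hw : ∀ t, w ≠ .inl (t, j)) :
    tangent m k v (quartic k w j) = if v = w then 1 else 0 := by
  have e (x y z : Var m) : dualCubic m k (X x * (X y * X z)) =
      if third y z = some x then 1 else 0 := dualCubic_X_mul hm x y z
  have h01 : third (.inl (0, j)) (.inl (1, j)) = some (.inl (2, j) : Var m) := by
    simp [third]; rfl
  have h02 : third (.inl (0, j)) (.inl (2, j)) = some (.inl (1, j) : Var m) := by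
    simp [third]; rfl
  have h12 : third (.inl (1, j)) (.inl (2, j)) = some (.inl (0, j) : Var m) := by
    simp [third]
  have hw0 := hw 0
  have hw1 := hw 1
  have hw2 := hw 2
  simp only [tangent, quartic, LinearMap.comp_apply, Derivation.coeFn_coe, Derivation.leibniz,
    pderiv_X, smul_eq_mul]
  by_cases h0 : v = .inl (0, j)
  · subst h0
    simp [hw0, e, h12, hw0.symm]
  by_cases h1 : v = .inl (1, j)
  · subst h1
    simp [hw1, e, h02, hw1.symm]
  by_cases h2 : v = .inl (2, j)
  · subst h2
    simp [hw2, e, h01, hw2.symm]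
  by_cases h3 : v = w
  · subst h3
    simp [e, h12, Ne.symm h0, Ne.symm h1, Ne.symm h2]
  · simp [h3, Ne.symm h0, Ne.symm h1, Ne.symm h2, Ne.symm h3]

/-- An index different from the index of the variable, if it has one. -/
def otherIndex {m : ℕ} : Var m → ZMod m
  | .inl (_, i) => i + 1
  | .inr _ => 0

omit [NeZero m] in
theorem ne_otherIndex (hm : 6 ≤ m) (w : Var m) (t : Fin 3) : w ≠ .inl (t, otherIndex w) := by
  obtain ⟨s, i⟩ | ⟨⟩ := w
  · simp [otherIndex, add_one_ne_self hm i]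
  · simp

/-- The class of a quartic modulo the square of the apolar ideal, minus its expected value. -/
noncomputable def defect (m : ℕ) [NeZero m] (k : Type*) [Field k] :
    MvPolynomial (Var m) k →ₗ[k] MvPolynomial (Var m) k ⧸ (apolarIdeal m k) ^ 2 :=
  quot _ - ∑ v, (tangent m k v).smulRight (quot _ (quartic k v (otherIndex v)))

theorem defect_apply (p : MvPolynomial (Var m) k) : defect m k p =
    quot _ p - ∑ v, tangent m k v p • quot _ (quartic k v (otherIndex v)) := by
  simp [defect]

theorem defect_mul_eq_zero {p q : MvPolynomial (Var m) k}
    (hp : p ∈ apolarIdeal m k) (hq : q ∈ apolarIdeal m k) : defect m k (p * q) = 0 := by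
  rw [defect_apply, quot_eq_zero.2 (pow_two (apolarIdeal m k) ▸ Ideal.mul_mem_mul hp hq)]
  simp [tangent_mul_eq_zero _ hp hq]

theorem defect_quartic (hm : 6 ≤ m) (w : Var m) :
    defect m k (quartic k w (otherIndex w)) = 0 := by
  simp [defect_apply, tangent_quartic hm _ w _ (ne_otherIndex hm w)]

theorem quarticRelations_defect (hm : 6 ≤ m) : QuarticRelations fun w x y z : Var m =>
    defect m k (X w * (X x * (X y * X z))) where
  swap_left w x y z := congrArg _ (by ring)
  swap_mid w x y z := congrArg _ (by ring)
  swap_right w x y z := congrArg _ (by ring)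
  zero_zero {w x y z} h₁ h₂ := by
    rw [← mul_assoc]
    exact defect_mul_eq_zero (X_mul_X_mem_apolarIdeal hm h₁) (X_mul_X_mem_apolarIdeal hm h₂)
  zero_congr {w x y z y' z'} h₁ h₂ := by
    rw [← sub_eq_zero, ← map_sub, ← mul_sub, ← mul_sub, ← mul_assoc]
    exact defect_mul_eq_zero (X_mul_X_mem_apolarIdeal hm h₁) (X_mul_X_sub_mem_apolarIdeal hm h₂)
  exchange {w x y z w' x' y' z'} h₁ h₂ := by
    have := defect_mul_eq_zero (X_mul_X_sub_mem_apolarIdeal (k := k) hm h₁)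
      (X_mul_X_sub_mem_apolarIdeal hm h₂)
    rw [← sub_eq_zero, ← map_add, ← map_add, ← map_sub, ← this]
    exact congrArg _ (by ring)
  -- The indices `i + 1` and, for `d`, `0` in the normalization are those of `otherIndex`.
  base t i := defect_quartic hm (.inl (t, i))
  base_d := defect_quartic hm (.inr ())

theorem defect_eq_zero (hm : 6 ≤ m) {p : MvPolynomial (Var m) k}
    (hp : p ∈ homogeneousSubmodule (Var m) k 4) : defect m k p = 0 :=
  homogeneousSubmodule_four_le (N := LinearMap.ker (defect m k))
    (fun w x y z => (quarticRelations_defect hm).eq_zero hm w x y z) hp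

omit [NeZero m] in
theorem quartic_mem (w : Var m) (j : ZMod m) :
    quartic k w j ∈ homogeneousSubmodule (Var m) k 4 :=
  (isHomogeneous_X k w).mul (X_mul_X_mul_X_isHomogeneous _ _ _)

theorem hilbert_sq_four (hm : 6 ≤ m) :
    hilbertFunction ((apolarIdeal m k) ^ 2) 4 = Fintype.card (Var m) := by
  refine hilbertFunction_eq_card (fun v => quartic k v (otherIndex v)) (fun v => quartic_mem _ _)
    (fun p hp => ?_) (tangent m k) (fun v p hp => tangent_eq_zero v hp)
    fun v w => tangent_quartic hm v w _ (ne_otherIndex hm w)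
  have := defect_eq_zero hm hp
  rw [defect_apply, sub_eq_zero] at this
  rw [Submodule.mem_comap, this]
  exact Submodule.sum_mem _ fun v _ => Submodule.smul_mem _ _ (Submodule.subset_span ⟨v, rfl⟩)

/-- Away from index `j`, only `cⱼ₋₁` and `cⱼ₊₁` are collinear with `cⱼ`, and they are not collinear
with `aⱼ`. So `v * cⱼ` or `v * aⱼ` lies in the ideal, and so does the remaining cubic, as `w` is not
the third variable of its pair. -/
theorem X_mul_quartic_mem (hm : 6 ≤ m) (v w : Var m) {j : ZMod m} (hv : ∀ t, v ≠ .inl (t, j))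
    (hw : ∀ t, w ≠ .inl (t, j)) : X v * quartic k w j ∈ (apolarIdeal m k) ^ 2 := by
  have cubic {x y z u : Var m} (h : third y z = some u) (hx : x ≠ u) :
      (X x * (X y * X z) : MvPolynomial (Var m) k) ∈ apolarIdeal m k :=
    cubic_mem_apolarIdeal (X_mul_X_mul_X_isHomogeneous _ _ _) (by
      simp [dualCubic_X_mul hm, h, hx.symm])
  rw [pow_two]
  by_cases h : third v (.inl (2, j)) = none
  · have h01 : third (.inl (0, j)) (.inl (1, j)) = some (.inl (2, j) : Var m) := by
      simp [third]; rfl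
    have := Ideal.mul_mem_mul (X_mul_X_mem_apolarIdeal (k := k) hm h) (cubic h01 (hw 2))
    convert this using 1
    rw [quartic]
    ring
  · have h12 : third (.inl (1, j)) (.inl (2, j)) = some (.inl (0, j) : Var m) := by
      simp [third]
    have h0 : third v (.inl (0, j)) = none := by
      obtain ⟨t, i⟩ | ⟨⟩ := v
      · have := hv t
        fin_cases t <;> simp [third] at h this ⊢ <;> grind
      · simp [third] at h
    have := Ideal.mul_mem_mul (X_mul_X_mem_apolarIdeal (k := k) hm h0) (cubic h12 (hw 0))
    convert this using 1
    rw [quartic]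
    ring

theorem exists_common_otherIndex (hm : 6 ≤ m) (v w : Var m) :
    ∃ j, (∀ t, v ≠ .inl (t, j)) ∧ ∀ t, w ≠ .inl (t, j) := by
  let index : Var m → ZMod m := Sum.elim Prod.snd fun _ => 0
  obtain ⟨j, hj⟩ := QuarticRelations.exists_notMem_of_card_le_five hm {index v, index w}
    (Finset.card_le_two.trans (by norm_num))
  simp only [Finset.mem_insert, Finset.mem_singleton, not_or] at hj
  exact ⟨j, fun t h => hj.1 (by simp [h, index]), fun t h => hj.2 (by simp [h, index])⟩

/-- The tangent functionals take the same values on `quartic k w j` for all admissible `j`, so by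
`defect_eq_zero` a change of `j` stays within the square of the ideal. -/
theorem X_mul_quartic_otherIndex_mem (hm : 6 ≤ m) (v w : Var m) :
    X v * quartic k w (otherIndex w) ∈ (apolarIdeal m k) ^ 2 := by
  obtain ⟨j, hv, hw⟩ := exists_common_otherIndex hm v w
  have h := defect_eq_zero hm (quartic_mem (k := k) w j)
  rw [defect_apply] at h
  simp only [tangent_quartic hm _ w j hw, ite_smul, one_smul, zero_smul, Finset.sum_ite_eq',
    Finset.mem_univ, if_true, ← map_sub, quot_eq_zero] at h
  have := Ideal.sub_mem _ (X_mul_quartic_mem (k := k) hm v w hv hw) (Ideal.mul_mem_left _ (X v) h)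
  rwa [mul_sub, sub_sub_cancel] at this

theorem hilbert_sq_five (hm : 6 ≤ m) : hilbertFunction ((apolarIdeal m k) ^ 2) 5 = 0 := by
  refine hilbertFunction_eq_zero (homogeneousSubmodule_succ_le
    (N := ((apolarIdeal m k) ^ 2).restrictScalars k) fun v q hq => ?_)
  have h := defect_eq_zero hm hq
  simp only [defect_apply, ← map_smul, ← map_sum, ← map_sub, quot_eq_zero] at h
  have h' := Ideal.mul_mem_left _ (X v) h
  rw [mul_sub, Finset.mul_sum] at h'
  refine (Submodule.sub_mem_iff_left _ (Submodule.sum_mem _ fun w _ => ?_)).1 h'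
  rw [mul_smul_comm]
  exact Submodule.smul_of_tower_mem _ _ (X_mul_quartic_otherIndex_mem hm v w)

end Apolar
end SmallTangent

theorem mainTheorem5 {k : Type*} [Field k] (m : ℕ) [NeZero m] (hm : 6 ≤ m) :
    Fintype.card (SmallTangent.Var m) = 3 * m + 1 ∧
      SmallTangent.SmallTangentSpaceCondition
        (SmallTangent.dualElement (SmallTangent.cubicF' k m)) := by
  refine ⟨by simp [ZMod.card], ?_⟩
  exact
    { homogeneous := SmallTangent.isHomogeneousOfDegree_dualElement m k
      hilbert_zero := SmallTangent.hilbert_zero hm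
      hilbert_one := SmallTangent.hilbert_one hm
      hilbert_two := SmallTangent.hilbert_two hm
      hilbert_three := SmallTangent.hilbert_three hm
      hilbert_ge_four := SmallTangent.hilbert_ge_four
      hilbert_sq_four := SmallTangent.hilbert_sq_four hm
      hilbert_sq_five := SmallTangent.hilbert_sq_five hm }
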